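/- Let $X$ be a real Banach space with dual $X^*$; write $S(\cdot)$ for unit spheres, $B[z,r]$ for the closed ball of $X$ with centre $z$ and radius $r$, and let $\mathcal Z$ be the family of all w*-closed subspaces of $X^*$ of finite codimension. For a subspace $Z\subseteq X^*$ let $B(Z)=\{g\in Z:\|g\|\le 1\}$, $\|x\|_Z=\sup_{g\in B(Z)}|g(x)|$ and $B_Z[x,r]=\{y\in X:\|y-x\|_Z\le r\}$ for $x\in X$, and let $S(B(Z),x,\alpha)=\{g\in B(Z): g(x)>\alpha\}$; diameters of subsets of $X^*$ are taken in the dual norm. The following are equivalent: (a) $X$ is asymptotically uniformly smooth (AUS): $\lim_{t\to0^+}\overline\rho(t)/t=0$, where $\overline\rho(t)=\sup_{x\in S(X)}\ \inf_{Y\subseteq X,\ \dim(X/Y)<\infty}\ \sup_{y\in Y,\ \|y\|=t}(\|x+y\|-1)$, and $\sup\emptyset=0$; (b) $X^*$ is w*-asymptotically uniformly convex (w*-AUC): for every $t>0$, $\ \inf_{f\in S(X^*)}\ \sup_{Y\in\mathcal Z}\ \inf_{g\in Y,\ \|g\|=t}(\|f+g\|-1)>0$, where $\inf\emptyset=+\infty$;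 (c) $X^*$ is w*-AUD (I): for every $0<\varepsilon\le 2$ there is $\delta\in(0,1)$ such that for every $f\in S(X^*)$ there are $Z\in\mathcal Z$ with $f\in Z$ and $x\in S(X)$ with $f(x)>0$ such that $\operatorname{diam} S(B(Z),x,f(x)(1-\delta))<\varepsilon$; (d) $X^*$ is w*-AUD (II): for every $\varepsilon>0$ there is $\delta\in(0,1)$ such that for every $f\in S(X^*)$ there are $Z\in\mathcal Z$ with $f\in Z$ and $x\in S(X)$ with $\|x\|_Z=1$ such that $f\in S(B(Z),x,1-\delta)$ and $\operatorname{diam} S(B(Z),x,1-\delta)<\varepsilon$; (e) $X$ has the asymptotic hyperplane uniform Mazur intersection property (AHUMIP): for every $\varepsilon>0$ and $M\ge1$ there are $\gamma,K>0$ such that for every $f\in S(X^*)$ there is $Z\in\mathcal Z$ with $f\in Z$ such that for every closed convex set $C\subseteq X$ with $C\subseteq B_Z[0,M]$ and $\inf f(C)\ge\varepsilon$ (where $\inf\emptyset=+\infty$) there are $z_0\in X$ and $0<r_0\le K$ with $C\subseteq B_Z[z_0,r_0]$ and $\inf f(B[z_0,r_0])\ge\gamma$. -/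

import Mathlib

open Filter Topology

/-- The modulus of asymptotic uniform smoothness
`ρ(t) = sup_{x ∈ S(X)} inf_{dim(X/Y) < ∞} sup_{y ∈ Y, ‖y‖ = t} (‖x + y‖ - 1)`.
All the sets involved are bounded, and whenever `{y ∈ Y : ‖y‖ = t}` is non-empty the inner
supremum is non-negative; suprema over the empty set (`X` finite-dimensional) are `0`. -/
noncomputable def ausModulus (X : Type*) [NormedAddCommGroup X] [NormedSpace ℝ X] (t : ℝ) : ℝ :=
  ⨆ x : {x : X // ‖x‖ = 1}, ⨅ Y : {Y : Submodule ℝ X // FiniteDimensional ℝ (X ⧸ Y)},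
    ⨆ y : {y : X // y ∈ Y.1 ∧ ‖y‖ = t}, (‖x.1 + y.1‖ - 1)

/-- `X` is asymptotically uniformly smooth: `ρ(t) / t → 0` as `t → 0+`. -/
def IsAUS (X : Type*) [NormedAddCommGroup X] [NormedSpace ℝ X] : Prop :=
  Tendsto (fun t : ℝ => ausModulus X t / t) (𝓝[>] 0) (𝓝 0)

/-- `Z` is a w*-closed subspace of `X*` of finite codimension. -/
def IsWStarCofinite {X : Type*} [NormedAddCommGroup X] [NormedSpace ℝ X]
    (Z : Submodule ℝ (StrongDual ℝ X)) : Prop :=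
  IsClosed {φ : WeakDual ℝ X | WeakDual.toStrongDual φ ∈ Z} ∧
    FiniteDimensional ℝ (StrongDual ℝ X ⧸ Z)

/-- The modulus of w*-asymptotic uniform convexity of `X*`,
`Δ*(t) = inf_{f ∈ S(X*)} sup_Y inf_{g ∈ Y, ‖g‖ = t} (‖f + g‖ - 1)`, where `Y` ranges over the
w*-closed finite-codimensional subspaces of `X*`. It is an extended real: infima over the empty
set are `+∞`. -/
noncomputable def wStarAUCModulus (X : Type*) [NormedAddCommGroup X] [NormedSpace ℝ X]
    (t : ℝ) : EReal :=
  ⨅ f : {f : StrongDual ℝ X // ‖f‖ = 1},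
    ⨆ Y : {Y : Submodule ℝ (StrongDual ℝ X) // IsWStarCofinite Y},
      ⨅ g : {g : StrongDual ℝ X // g ∈ Y.1 ∧ ‖g‖ = t}, ((‖f.1 + g.1‖ - 1 : ℝ) : EReal)

/-- `X*` is w*-asymptotically uniformly convex. -/
def DualIsWStarAUC (X : Type*) [NormedAddCommGroup X] [NormedSpace ℝ X] : Prop :=
  ∀ t : ℝ, 0 < t → 0 < wStarAUCModulus X t

/-- The w*-slice `S(B(Z), x, α) = {g ∈ B(Z) : g(x) > α}` of the unit ball of `Z ⊆ X*`. -/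
def wStarSlice {X : Type*} [NormedAddCommGroup X] [NormedSpace ℝ X]
    (Z : Submodule ℝ (StrongDual ℝ X)) (x : X) (α : ℝ) : Set (StrongDual ℝ X) :=
  {g | g ∈ Z ∧ ‖g‖ ≤ 1 ∧ α < g x}

/-- The seminorm `‖x‖_Z = sup_{f ∈ B(Z)} |f(x)|`. -/
noncomputable def dualSeminorm {X : Type*} [NormedAddCommGroup X] [NormedSpace ℝ X]
    (Z : Submodule ℝ (StrongDual ℝ X)) (x : X) : ℝ :=
  ⨆ f : {f : StrongDual ℝ X // f ∈ Z ∧ ‖f‖ ≤ 1}, |f.1 x|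

/-- The closed ball `B_Z[x, r]` of the seminorm `‖·‖_Z`. -/
def dualClosedBall {X : Type*} [NormedAddCommGroup X] [NormedSpace ℝ X]
    (Z : Submodule ℝ (StrongDual ℝ X)) (x : X) (r : ℝ) : Set X :=
  {y | dualSeminorm Z (y - x) ≤ r}

/-- `X*` is w*-asymptotically uniformly denting (I). The level `f x * (1 - δ)` of a slice lies in
`(0, 1)`, which for `0 < δ < 1` means `0 < f x`. -/
def DualIsWStarAUDI (X : Type*) [NormedAddCommGroup X] [NormedSpace ℝ X] : Prop :=
  ∀ ε : ℝ, 0 < ε → ε ≤ 2 → ∃ δ : ℝ, 0 < δ ∧ δ < 1 ∧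
    ∀ f : StrongDual ℝ X, ‖f‖ = 1 →
      ∃ Z : Submodule ℝ (StrongDual ℝ X), IsWStarCofinite Z ∧ f ∈ Z ∧
        ∃ x : X, ‖x‖ = 1 ∧ 0 < f x ∧ Metric.diam (wStarSlice Z x (f x * (1 - δ))) < ε

/-- `X*` is w*-asymptotically uniformly denting (II). The level `1 - δ` of a slice lies in
`(0, 1)`. -/
def DualIsWStarAUDII (X : Type*) [NormedAddCommGroup X] [NormedSpace ℝ X] : Prop :=
  ∀ ε : ℝ, 0 < ε → ∃ δ : ℝ, 0 < δ ∧ δ < 1 ∧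
    ∀ f : StrongDual ℝ X, ‖f‖ = 1 →
      ∃ Z : Submodule ℝ (StrongDual ℝ X), IsWStarCofinite Z ∧ f ∈ Z ∧
        ∃ x : X, ‖x‖ = 1 ∧ dualSeminorm Z x = 1 ∧ f ∈ wStarSlice Z x (1 - δ) ∧
          Metric.diam (wStarSlice Z x (1 - δ)) < ε

/-- `X` has the asymptotic hyperplane uniform Mazur intersection property. -/
def HasAHUMIP (X : Type*) [NormedAddCommGroup X] [NormedSpace ℝ X] : Prop :=
  ∀ ε M : ℝ, 0 < ε → 1 ≤ M → ∃ γ K : ℝ, 0 < γ ∧ 0 < K ∧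
    ∀ f : StrongDual ℝ X, ‖f‖ = 1 →
      ∃ Z : Submodule ℝ (StrongDual ℝ X), IsWStarCofinite Z ∧ f ∈ Z ∧
        ∀ C : Set X, IsClosed C → Convex ℝ C → C ⊆ dualClosedBall Z 0 M →
          (∀ c ∈ C, ε ≤ f c) →
          ∃ (z₀ : X) (r₀ : ℝ), 0 < r₀ ∧ r₀ ≤ K ∧ C ⊆ dualClosedBall Z z₀ r₀ ∧
            ∀ z ∈ Metric.closedBall z₀ r₀, γ ≤ f z

/-! ### Annihilators, dual seminorms and slices. -/

section AsymptoticDuality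

variable {X : Type*} [NormedAddCommGroup X] [NormedSpace ℝ X]

/-! Everything passes through w*-AUC. The w*-closed subspaces of finite codimension are exactly the
annihilators of finite-dimensional `F ⊆ X`, so w*-AUC says that adding to a unit functional `f` a
large `g` vanishing on a suitable `F` raises the norm by a uniform amount.

To get small slices (`DualIsWStarAUC.exists_small_slice`), maximise `f` on the sphere of `F`, at
`x₀`, and let `Z` annihilate `F ∩ ker f`. On `F` a member of `Z` is a multiple of `f`; in the slice
at `x₀` the multiple is close to 1, and w*-AUC makes the remainder small. Both denting properties
follow, and so does AHUMIP, with a large ball centred far out along `x₀`. Conversely, if `f + g` is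
hardly longer than `f` and `g` vanishes at the slicing point, rescaling keeps it in the slice, so
`g` is small. AHUMIP returns to denting by the parallel hyperplane lemma.

AUS gives w*-AUC by testing `f + g` on perturbations of a point nearly norming `f`; the converse
uses w*-compactness of the dual ball. -/

/-- The annihilator in `X*` of a subspace of `X`. -/
def topDualAnnihilator (F : Submodule ℝ X) : Submodule ℝ (StrongDual ℝ X) where
  carrier := {g | ∀ x ∈ F, g x = 0}
  add_mem' := fun ha hb x hx => by simp [ha x hx, hb x hx]
  zero_mem' := fun x _ => rfl
  smul_mem' := fun c g hg x hx => by simp [hg x hx]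

theorem mem_topDualAnnihilator {F : Submodule ℝ X} {g : StrongDual ℝ X} :
    g ∈ topDualAnnihilator F ↔ ∀ x ∈ F, g x = 0 := Iff.rfl

theorem isWStarCofinite_topDualAnnihilator (F : Submodule ℝ X) [FiniteDimensional ℝ F] :
    IsWStarCofinite (topDualAnnihilator F) := by
  constructor
  · have : {φ : WeakDual ℝ X | WeakDual.toStrongDual φ ∈ topDualAnnihilator F} =
        ⋂ x ∈ F, {φ : WeakDual ℝ X | φ x = 0} := by
      ext φ; simp [mem_topDualAnnihilator]
    rw [this]
    exact isClosed_biInter fun x _ =>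
      isClosed_eq (WeakDual.eval_continuous x) continuous_const
  · let R : StrongDual ℝ X →ₗ[ℝ] Module.Dual ℝ F :=
      { toFun := fun g => (g : X →ₗ[ℝ] ℝ).domRestrict F
        map_add' := fun _ _ => rfl
        map_smul' := fun _ _ => rfl }
    have : topDualAnnihilator F = LinearMap.ker R := by
      ext g
      rw [mem_topDualAnnihilator, LinearMap.mem_ker, LinearMap.ext_iff]
      exact ⟨fun h x => h x x.2, fun h x hx => h ⟨x, hx⟩⟩
    rw [this]
    exact Submodule.CoFG.ker R

/-- The quotient by a w*-closed subspace is Hausdorff and finite-dimensional, so its coordinates are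
w*-continuous functionals, hence evaluations at points of `X`; these points span `F`. -/
theorem IsWStarCofinite.exists_eq_topDualAnnihilator {Z : Submodule ℝ (StrongDual ℝ X)}
    (hZ : IsWStarCofinite Z) :
    ∃ F : Submodule ℝ X, FiniteDimensional ℝ F ∧ Z = topDualAnnihilator F := by
  obtain ⟨hc, hf⟩ := hZ
  let W : Submodule ℝ (WeakDual ℝ X) := Z.comap (WeakDual.toStrongDual).toLinearMap
  have hWc : IsClosed (W : Set (WeakDual ℝ X)) := hc
  have hWf : FiniteDimensional ℝ (WeakDual ℝ X ⧸ W) := hf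
  let b := Module.finBasis ℝ (WeakDual ℝ X ⧸ W)
  have key : ∀ i, ∃ x : X, ∀ φ : WeakDual ℝ X, b.coord i (W.mkQ φ) = φ x := by
    intro i
    let ψ : WeakDual ℝ X →L[ℝ] ℝ :=
      ⟨(b.coord i).comp W.mkQ, by
        have h1 : Continuous (b.coord i) := LinearMap.continuous_of_finiteDimensional _
        exact h1.comp (continuous_quot_mk)⟩
    obtain ⟨x, hx⟩ := LinearMap.dualEmbedding_surjective (topDualPairing ℝ X) ψ
    exact ⟨x, fun φ => (DFunLike.congr_fun hx φ).symm⟩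
  choose x hx using key
  refine ⟨Submodule.span ℝ (Set.range x),
    FiniteDimensional.span_of_finite ℝ (Set.finite_range x), ?_⟩
  ext g
  have h1 : g ∈ Z ↔ W.mkQ (StrongDual.toWeakDual g) = 0 := by
    rw [Submodule.mkQ_apply, Submodule.Quotient.mk_eq_zero]; rfl
  rw [h1, mem_topDualAnnihilator, ← b.forall_coord_eq_zero_iff]
  constructor
  · intro h y hy
    induction hy using Submodule.span_induction with
    | mem y hy => obtain ⟨i, rfl⟩ := hy; rw [← StrongDual.toWeakDual_apply, ← hx, h]
    | zero => simp
    | add a b _ _ ha hb => simp [ha, hb]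
    | smul c a _ ha => simp [ha]
  · intro h i
    rw [hx]
    exact h _ (Submodule.subset_span ⟨i, rfl⟩)

theorem IsWStarCofinite.inf_eval {Z : Submodule ℝ (StrongDual ℝ X)} (hZ : IsWStarCofinite Z)
    (x : X) : ∃ Y : Submodule ℝ (StrongDual ℝ X), IsWStarCofinite Y ∧
      ∀ g ∈ Y, g ∈ Z ∧ g x = 0 := by
  obtain ⟨F, _, rfl⟩ := hZ.exists_eq_topDualAnnihilator
  refine ⟨topDualAnnihilator (F ⊔ Submodule.span ℝ {x}), isWStarCofinite_topDualAnnihilator _,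
    fun g hg => ⟨fun y hy => hg y (le_sup_left (a := F) hy), hg x ?_⟩⟩
  exact le_sup_right (a := F) (Submodule.mem_span_singleton_self x)

/-- Norms along a segment from the unit sphere: if `‖f + s g‖ ≥ 1 + η` with `s ∈ (0, 1]` and
`‖f‖ = 1`, then `‖f + g‖ ≥ 1 + η`. -/
theorem one_add_le_norm_add_of_smul {E : Type*} [NormedAddCommGroup E] [NormedSpace ℝ E]
    {f g : E} {s η : ℝ} (hf : ‖f‖ = 1) (hs : 0 < s) (hs1 : s ≤ 1) (hη : 0 ≤ η)
    (h : 1 + η ≤ ‖f + s • g‖) : 1 + η ≤ ‖f + g‖ := by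
  have h1 : f + s • g = (1 - s) • f + s • (f + g) := by module
  have h2 : ‖f + s • g‖ ≤ (1 - s) + s * ‖f + g‖ := by
    rw [h1]
    refine (norm_add_le _ _).trans ?_
    rw [norm_smul, norm_smul, Real.norm_of_nonneg hs.le, Real.norm_of_nonneg (by linarith), hf]
    linarith
  nlinarith

theorem dualIsWStarAUC_iff : DualIsWStarAUC X ↔ ∀ t : ℝ, 0 < t → ∃ η : ℝ, 0 < η ∧
    ∀ f : StrongDual ℝ X, ‖f‖ = 1 → ∃ Y : Submodule ℝ (StrongDual ℝ X), IsWStarCofinite Y ∧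
      ∀ g ∈ Y, ‖g‖ = t → 1 + η ≤ ‖f + g‖ := by
  refine forall₂_congr fun t ht => ⟨fun h => ?_, ?_⟩
  · obtain ⟨η, h0, h1⟩ := EReal.lt_iff_exists_real_btwn.1 h
    refine ⟨η, by exact_mod_cast h0, fun f hf => ?_⟩
    have h2 := h1.trans_le (iInf_le _ (⟨f, hf⟩ : {f : StrongDual ℝ X // ‖f‖ = 1}))
    obtain ⟨Y, hY⟩ := lt_iSup_iff.1 h2
    refine ⟨Y.1, Y.2, fun g hg hgt => ?_⟩
    have h3 := hY.trans_le (iInf_le _ (⟨g, hg, hgt⟩ : {g : StrongDual ℝ X // g ∈ Y.1 ∧ ‖g‖ = t}))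
    have h4 : η < ‖f + g‖ - 1 := by exact_mod_cast h3
    linarith
  · rintro ⟨η, hη, h⟩
    refine lt_of_lt_of_le (b := (η : EReal)) (by exact_mod_cast hη) (le_iInf fun f => ?_)
    obtain ⟨Y, hY, hYg⟩ := h f.1 f.2
    refine le_iSup_of_le ⟨Y, hY⟩ (le_iInf fun g => ?_)
    have := hYg g.1 g.2.1 g.2.2
    exact_mod_cast (by linarith : η ≤ ‖f.1 + g.1‖ - 1)

theorem DualIsWStarAUC.exists_annihilator (h : DualIsWStarAUC X) {t : ℝ} (ht : 0 < t) :
    ∃ η : ℝ, 0 < η ∧ ∀ f : StrongDual ℝ X, ‖f‖ = 1 →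
      ∃ F : Submodule ℝ X, FiniteDimensional ℝ F ∧
        ∀ g ∈ topDualAnnihilator F, t ≤ ‖g‖ → 1 + η ≤ ‖f + g‖ := by
  obtain ⟨η, hη, H⟩ := dualIsWStarAUC_iff.1 h t ht
  refine ⟨η, hη, fun f hf => ?_⟩
  obtain ⟨Y, hY, hYg⟩ := H f hf
  obtain ⟨F, hF, rfl⟩ := hY.exists_eq_topDualAnnihilator
  refine ⟨F, hF, fun g hg htg => ?_⟩
  have hg0 : 0 < ‖g‖ := ht.trans_le htg
  refine one_add_le_norm_add_of_smul (s := t / ‖g‖) hf (by positivity)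
    ((div_le_one hg0).2 htg) hη.le (hYg _ (Submodule.smul_mem _ _ hg) ?_)
  rw [norm_smul, Real.norm_of_nonneg (by positivity)]
  field_simp

theorem bddAbove_dualSeminorm (Z : Submodule ℝ (StrongDual ℝ X)) (x : X) :
    BddAbove (Set.range fun f : {f : StrongDual ℝ X // f ∈ Z ∧ ‖f‖ ≤ 1} => |f.1 x|) := by
  refine ⟨‖x‖, ?_⟩
  rintro _ ⟨f, rfl⟩
  exact (f.1.le_opNorm x).trans (mul_le_of_le_one_left (norm_nonneg x) f.2.2)

theorem dualSeminorm_le_iff {Z : Submodule ℝ (StrongDual ℝ X)} {x : X} {r : ℝ} :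
    dualSeminorm Z x ≤ r ↔ ∀ g ∈ Z, ‖g‖ ≤ 1 → |g x| ≤ r := by
  constructor
  · intro h g hg hg1
    exact (le_ciSup (bddAbove_dualSeminorm Z x)
      (⟨g, hg, hg1⟩ : {f : StrongDual ℝ X // f ∈ Z ∧ ‖f‖ ≤ 1})).trans h
  · intro h
    have : Nonempty {f : StrongDual ℝ X // f ∈ Z ∧ ‖f‖ ≤ 1} := ⟨⟨0, Z.zero_mem, by simp⟩⟩
    exact ciSup_le fun g => h g.1 g.2.1 g.2.2

theorem dualSeminorm_le_norm (Z : Submodule ℝ (StrongDual ℝ X)) (x : X) :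
    dualSeminorm Z x ≤ ‖x‖ :=
  dualSeminorm_le_iff.2 fun g _ hg =>
    (g.le_opNorm x).trans (mul_le_of_le_one_left (norm_nonneg x) hg)

theorem abs_apply_le_norm_mul_dualSeminorm {Z : Submodule ℝ (StrongDual ℝ X)} {g : StrongDual ℝ X}
    (hg : g ∈ Z) (x : X) : |g x| ≤ ‖g‖ * dualSeminorm Z x := by
  rcases eq_or_ne g 0 with rfl | h0
  · simp
  have hn : 0 < ‖g‖ := norm_pos_iff.2 h0
  have h := dualSeminorm_le_iff.1 (le_refl (dualSeminorm Z x)) (‖g‖⁻¹ • g) (Z.smul_mem _ hg)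
    (by rw [norm_smul, norm_inv, norm_norm, inv_mul_cancel₀ hn.ne'])
  rw [_root_.smul_apply, smul_eq_mul, abs_mul, abs_of_pos (inv_pos.2 hn),
    inv_mul_le_iff₀ hn] at h
  exact h

theorem isBounded_wStarSlice (Z : Submodule ℝ (StrongDual ℝ X)) (x : X) (α : ℝ) :
    Bornology.IsBounded (wStarSlice Z x α) :=
  (Metric.isBounded_closedBall (x := (0 : StrongDual ℝ X)) (r := 1)).subset fun g hg => by
    simpa using hg.2.1

theorem norm_sub_le_diam_wStarSlice {Z : Submodule ℝ (StrongDual ℝ X)} {x : X} {α : ℝ}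
    {g h : StrongDual ℝ X} (hg : g ∈ wStarSlice Z x α) (hh : h ∈ wStarSlice Z x α) :
    ‖g - h‖ ≤ Metric.diam (wStarSlice Z x α) := by
  rw [← dist_eq_norm]
  exact Metric.dist_le_diam_of_mem (isBounded_wStarSlice Z x α) hg hh

theorem diam_wStarSlice_le {Z : Submodule ℝ (StrongDual ℝ X)} {x : X} {α r : ℝ} (hr : 0 ≤ r)
    {f : StrongDual ℝ X} (h : ∀ g ∈ wStarSlice Z x α, ‖g - f‖ ≤ r) :
    Metric.diam (wStarSlice Z x α) ≤ 2 * r := by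
  refine Metric.diam_le_of_forall_dist_le (by positivity) fun a ha b hb => ?_
  have := dist_triangle_right a b f
  rw [dist_eq_norm a f, dist_eq_norm b f] at this
  linarith [h a ha, h b hb]

theorem exists_norm_eq_one_lt_apply {f : StrongDual ℝ X} (hf : ‖f‖ = 1) {c : ℝ} (hc : c < 1) :
    ∃ x : X, ‖x‖ = 1 ∧ c < f x := by
  wlog hc0 : 0 ≤ c generalizing c
  · obtain ⟨x, hx, h⟩ := this one_half_lt_one (by norm_num)
    exact ⟨x, hx, by linarith⟩
  obtain ⟨x, hx1, hx⟩ := f.exists_lt_apply_of_lt_opNorm (hf.symm ▸ hc)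
  rw [Real.norm_eq_abs] at hx
  have hfx : f x ≠ 0 := fun h => by simp [h] at hx; linarith
  have hx0 : 0 < ‖x‖ := norm_pos_iff.2 fun h => hfx (by simp [h])
  refine ⟨(SignType.sign (f x) : ℝ) • ‖x‖⁻¹ • x, ?_, ?_⟩
  · rw [norm_smul, norm_smul, norm_inv, norm_norm, inv_mul_cancel₀ hx0.ne', mul_one]
    rcases hfx.lt_or_gt with h | h <;> simp [h]
  · rw [map_smul, map_smul, smul_eq_mul, smul_eq_mul, mul_left_comm, sign_mul_self]
    refine hx.trans_le ?_
    have h1 : 1 ≤ ‖x‖⁻¹ := (one_le_inv₀ hx0).2 hx1.le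
    nlinarith [abs_nonneg (f x)]

end AsymptoticDuality

/-! ### Slices, denting and the Mazur intersection property. -/

section AsymptoticDenting

variable {X : Type*} [NormedAddCommGroup X] [NormedSpace ℝ X]

theorem DualIsWStarAUDI.dualIsWStarAUC (h : DualIsWStarAUDI X) : DualIsWStarAUC X := by
  rw [dualIsWStarAUC_iff]
  intro t ht
  obtain ⟨δ, hδ, hδ1, H⟩ := h (min (t / 4) 1) (by positivity) ((min_le_right _ _).trans one_le_two)
  have hm : 0 < min (min (t / 4) 1) δ := by positivity
  set η := min (min (t / 4) 1) δ with hη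
  have e1 : η ≤ t / 4 := (min_le_left _ _).trans (min_le_left _ _)
  have e2 : η ≤ 1 := (min_le_left _ _).trans (min_le_right _ _)
  have e3 : η ≤ δ := min_le_right _ _
  refine ⟨η, hm, fun f hf => ?_⟩
  obtain ⟨Z, hZ, hfZ, x, -, hfx, hd⟩ := H f hf
  obtain ⟨Y, hY, hYZ⟩ := hZ.inf_eval x
  refine ⟨Y, hY, fun g hg hgt => ?_⟩
  obtain ⟨hgZ, hgx⟩ := hYZ g hg
  by_contra! hlt
  have hp : 0 < 1 + η := by linarith
  -- Since `g x = 0`, rescaling `f + g` into the ball multiplies the value `f x` only by `(1 + η)⁻¹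
  -- > 1 - δ`.
  have m1 : f ∈ wStarSlice Z x (f x * (1 - δ)) := ⟨hfZ, hf.le, by nlinarith⟩
  have m2 : (1 + η)⁻¹ • (f + g) ∈ wStarSlice Z x (f x * (1 - δ)) := by
    refine ⟨Z.smul_mem _ (Z.add_mem hfZ hgZ), ?_, ?_⟩
    · rw [norm_smul, norm_inv, Real.norm_of_nonneg hp.le, inv_mul_le_iff₀ hp]
      linarith
    · simp only [smul_apply, add_apply, hgx, add_zero, smul_eq_mul]
      rw [lt_inv_mul_iff₀ hp]
      have : (1 + η) * (1 - δ) < 1 := by nlinarith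
      nlinarith
  have h1 := (norm_sub_le_diam_wStarSlice m2 m1).trans_lt hd
  have h2 : g = (1 + η) • ((1 + η)⁻¹ • (f + g) - f) + η • f := by
    rw [smul_sub, smul_inv_smul₀ hp.ne']; module
  have h3 : ‖g‖ ≤ (1 + η) * ‖(1 + η)⁻¹ • (f + g) - f‖ + η := by
    conv_lhs => rw [h2]
    refine (norm_add_le _ _).trans ?_
    rw [norm_smul, norm_smul, hf, Real.norm_of_nonneg hp.le, Real.norm_of_nonneg hm.le, mul_one]
  have h4 : ‖(1 + η)⁻¹ • (f + g) - f‖ < t / 4 := h1.trans_le (min_le_left _ _)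
  nlinarith [norm_nonneg ((1 + η)⁻¹ • (f + g) - f)]

theorem DualIsWStarAUDII.dualIsWStarAUC (h : DualIsWStarAUDII X) : DualIsWStarAUC X := by
  rw [dualIsWStarAUC_iff]
  intro t ht
  obtain ⟨δ, hδ, hδ1, H⟩ := h (t / 8) (by positivity)
  have hm : 0 < min (t / 8) (δ / 4) := by positivity
  set η := min (t / 8) (δ / 4) with hη
  have e1 : η ≤ t / 8 := min_le_left _ _
  have e2 : η ≤ δ / 4 := min_le_right _ _
  refine ⟨η, hm, fun f hf => ?_⟩
  obtain ⟨Z, hZ, hfZ, x, -, hxZ, hfS, hd⟩ := H f hf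
  obtain ⟨Y, hY, hYZ⟩ := hZ.inf_eval x
  obtain ⟨k, hkZ, hk1, hkx⟩ : ∃ k ∈ Z, ‖k‖ ≤ 1 ∧ 1 - δ / 4 < k x := by
    by_contra! hcon
    have : dualSeminorm Z x ≤ 1 - δ / 4 := dualSeminorm_le_iff.2 fun g hg hg1 => by
      rw [abs_le']
      exact ⟨hcon g hg hg1, hcon (-g) (Z.neg_mem hg) (by rwa [norm_neg])⟩
    linarith
  refine ⟨Y, hY, fun g hg hgt => ?_⟩
  obtain ⟨hgZ, hgx⟩ := hYZ g hg
  by_contra! hlt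
  have hp : 0 < 1 + η := by linarith
  have hfx : 1 - δ < f x := hfS.2.2
  -- `f x` may barely exceed the level, leaving no room to rescale. Averaging with the nearly
  -- norming `k` lifts the value above `1 - 5δ/8`, which survives division by `1 + η`; the price is
  -- a factor 2 in `‖g‖`.
  set u : StrongDual ℝ X := (1 / 2 : ℝ) • (f + k) with hu
  set v : StrongDual ℝ X := (1 + η)⁻¹ • (1 / 2 : ℝ) • (f + g + k) with hv
  have m1 : u ∈ wStarSlice Z x (1 - δ) := by
    refine ⟨Z.smul_mem _ (Z.add_mem hfZ hkZ), ?_, ?_⟩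
    · rw [hu, norm_smul]
      have := norm_add_le f k
      norm_num; linarith
    · simp only [hu, smul_apply, add_apply, smul_eq_mul]
      linarith
  have m2 : v ∈ wStarSlice Z x (1 - δ) := by
    refine ⟨Z.smul_mem _ (Z.smul_mem _ (Z.add_mem (Z.add_mem hfZ hgZ) hkZ)), ?_, ?_⟩
    · rw [hv, norm_smul, norm_inv, Real.norm_of_nonneg hp.le, inv_mul_le_iff₀ hp, norm_smul]
      have := norm_add_le (f + g) k
      norm_num; linarith
    · simp only [hv, smul_apply, add_apply, hgx, add_zero, smul_eq_mul]
      rw [lt_inv_mul_iff₀ hp]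
      nlinarith
  have h1 := (norm_sub_le_diam_wStarSlice m2 m1).trans_lt hd
  have h2 : g = (2 : ℝ) • ((1 + η) • (v - u) + η • u) := by
    rw [smul_sub, hv, smul_inv_smul₀ hp.ne', hu]; module
  have h3 : ‖g‖ ≤ 2 * ((1 + η) * ‖v - u‖ + η) := by
    conv_lhs => rw [h2]
    rw [norm_smul, Real.norm_of_nonneg zero_le_two]
    gcongr
    refine (norm_add_le _ _).trans ?_
    rw [norm_smul, norm_smul, Real.norm_of_nonneg hp.le, Real.norm_of_nonneg hm.le]
    nlinarith [m1.2.1]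
  nlinarith [norm_nonneg (v - u)]

/-- A functional of norm one, restricted to the annihilator of `F ⊓ ker f` for a large
finite-dimensional `F`, is strongly exposed up to `ε` by a point of the unit sphere at which it is
as close to `1` as one wants. -/
theorem DualIsWStarAUC.exists_small_slice (h : DualIsWStarAUC X) {ε : ℝ} (hε : 0 < ε) :
    ∃ δ : ℝ, 0 < δ ∧ δ < 1 ∧ ∀ δ' : ℝ, 0 < δ' → ∀ f : StrongDual ℝ X, ‖f‖ = 1 →
      ∃ Z : Submodule ℝ (StrongDual ℝ X), IsWStarCofinite Z ∧ f ∈ Z ∧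
        ∃ x : X, ‖x‖ = 1 ∧ dualSeminorm Z x = 1 ∧ 1 - δ' < f x ∧
          ∀ g ∈ wStarSlice Z x (1 - δ), ‖g - f‖ ≤ ε := by
  obtain ⟨η, hη, H⟩ := h.exists_annihilator (t := ε / 2) (by positivity)
  have hm : 0 < min (min (ε / 4) (1 / 2)) (η / 4) := by positivity
  set δ := min (min (ε / 4) (1 / 2)) (η / 4) with hδ
  have e1 : δ ≤ ε / 4 := (min_le_left _ _).trans (min_le_left _ _)
  have e2 : δ ≤ 1 / 2 := (min_le_left _ _).trans (min_le_right _ _)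
  have e3 : δ ≤ η / 4 := min_le_right _ _
  refine ⟨δ, hm, by linarith, fun δ'' hδ'' f hf => ?_⟩
  obtain ⟨F₀, hF₀, HF₀⟩ := H f hf
  obtain ⟨δ', hδ'0, hδ'1, hδ'2⟩ : ∃ δ' : ℝ, 0 < δ' ∧ δ' ≤ δ ∧ δ' ≤ δ'' :=
    ⟨min δ δ'', by positivity, min_le_left _ _, min_le_right _ _⟩
  obtain ⟨x₁, hx₁, hfx₁⟩ := exists_norm_eq_one_lt_apply hf (c := 1 - δ') (by linarith)
  let F : Submodule ℝ X := F₀ ⊔ Submodule.span ℝ {x₁}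
  have hx₁F : x₁ ∈ F := le_sup_right (a := F₀) (Submodule.mem_span_singleton_self x₁)
  have : Nontrivial F := ⟨⟨x₁, hx₁F⟩, 0, fun h => by
    have : x₁ = 0 := congrArg Subtype.val h
    simp [this] at hx₁⟩
  -- `f` attains its norm on the finite-dimensional space `F`
  obtain ⟨x₀, hx₀m, hx₀⟩ := (isCompact_sphere (0 : F) 1).exists_isMaxOn
    (NormedSpace.sphere_nonempty.2 zero_le_one) (f.continuous.comp continuous_subtype_val).continuousOn
  have hx₀n : ‖(x₀ : X)‖ = 1 := by simpa using hx₀m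
  have hs : 1 - δ' < f x₀ := hfx₁.trans_le (hx₀ (a := ⟨x₁, hx₁F⟩) (by simpa using hx₁))
  set s := f x₀ with hsdef
  have hs1 : s ≤ 1 := by
    have := (le_abs_self _).trans (f.le_opNorm (x₀ : X))
    rwa [hf, hx₀n, mul_one] at this
  have hs0 : 0 < s := by linarith
  have hfF : ∀ y ∈ F, f y ≤ s * ‖y‖ := by
    intro y hy
    rcases eq_or_ne y 0 with rfl | hy0
    · simp
    have hn : 0 < ‖y‖ := norm_pos_iff.2 hy0
    have := hx₀ (a := (‖y‖⁻¹ • ⟨y, hy⟩ : F)) (by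
      simp [norm_smul, hn.ne'])
    simp only [Set.mem_ofPred_eq, Function.comp_apply, Submodule.coe_smul, map_smul,
      smul_eq_mul] at this
    rwa [inv_mul_le_iff₀ hn, mul_comm] at this
  set Z := topDualAnnihilator (F ⊓ LinearMap.ker (f : X →ₗ[ℝ] ℝ)) with hZ
  have hfZ : f ∈ Z := fun y hy => hy.2
  -- `F` is the sum of `F ∩ ker f` and the line through `x₀`, so `g` agrees on `F` with the multiple
  -- of `f` having the same value at `x₀`.
  have hdecomp : ∀ g ∈ Z, g - (g x₀ / s) • f ∈ topDualAnnihilator F₀ := by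
    intro g hg y hy
    have hyF : y ∈ F := le_sup_left (a := F₀) hy
    have := hg (y - (f y / s) • (x₀ : X)) ⟨F.sub_mem hyF (F.smul_mem _ x₀.2), by
      change f (y - (f y / s) • (x₀ : X)) = 0
      rw [map_sub, map_smul, smul_eq_mul, ← hsdef, div_mul_cancel₀ _ hs0.ne', sub_self]⟩
    simp only [map_sub, map_smul, smul_eq_mul] at this
    simp only [sub_apply, smul_apply, smul_eq_mul]
    rw [← this]; field_simp
  refine ⟨Z, isWStarCofinite_topDualAnnihilator _, hfZ, x₀, hx₀n, ?_, by linarith, ?_⟩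
  · refine le_antisymm ((dualSeminorm_le_norm _ _).trans hx₀n.le) ?_
    -- By maximality of `x₀`, `f / s` has norm at most 1 on `F`; its Hahn–Banach extension stays in
    -- `Z` and takes the value 1 at `x₀`.
    obtain ⟨k, hk, hkn⟩ := exists_extension_norm_eq F (s⁻¹ • f.comp F.subtypeL)
    have hkn1 : ‖k‖ ≤ 1 := by
      rw [hkn]
      refine ContinuousLinearMap.opNorm_le_bound _ zero_le_one fun y => ?_
      simp only [smul_apply, ContinuousLinearMap.comp_apply, Submodule.subtypeL_apply, smul_eq_mul,
        Real.norm_eq_abs, abs_mul, abs_of_pos (inv_pos.2 hs0), one_mul]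
      rw [inv_mul_le_iff₀ hs0, abs_le']
      exact ⟨hfF y y.2, by simpa using hfF _ (F.neg_mem y.2)⟩
    have hkZ : k ∈ Z := fun y hy => by
      have h1 := hk ⟨y, hy.1⟩
      have h2 : f y = 0 := hy.2
      simpa [h2] using h1
    have h1 := dualSeminorm_le_iff.1 (le_refl (dualSeminorm Z (x₀ : X))) k hkZ hkn1
    have h2 : k x₀ = 1 := by
      rw [hk x₀]; simp [← hsdef, hs0.ne']
    rwa [h2, abs_one] at h1
  · rintro g ⟨hgZ, hg1, hgx⟩
    set a := g x₀ / s with ha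
    have hgx1 : g x₀ ≤ 1 := by
      have := (le_abs_self _).trans (g.le_opNorm (x₀ : X))
      rw [hx₀n, mul_one] at this
      linarith
    have ha1 : 1 - δ ≤ a := by
      rw [ha, le_div_iff₀ hs0]; nlinarith
    have ha2 : a ≤ 1 + 2 * δ := by
      rw [ha, div_le_iff₀ hs0]; nlinarith
    have haa : |1 - a| ≤ 2 * δ := abs_le.2 ⟨by linarith, by linarith⟩
    have hlt : ‖g - a • f‖ < ε / 2 := by
      by_contra! hcon
      have h1 := HF₀ _ (hdecomp g hgZ) hcon
      -- The right side has norm at most `1 + 2δ ≤ 1 + η/2`.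
      have h2 : f + (g - a • f) = g + (1 - a) • f := by module
      rw [h2] at h1
      have h3 := norm_add_le g ((1 - a) • f)
      rw [norm_smul, hf, mul_one, Real.norm_eq_abs] at h3
      linarith
    have h2 : g - f = (g - a • f) - (1 - a) • f := by module
    have h3 := norm_sub_le (g - a • f) ((1 - a) • f)
    rw [norm_smul, hf, mul_one, Real.norm_eq_abs] at h3
    rw [h2]
    linarith

theorem DualIsWStarAUC.dualIsWStarAUDI (h : DualIsWStarAUC X) : DualIsWStarAUDI X := by
  intro ε hε _
  obtain ⟨δ, hδ, hδ1, H⟩ := h.exists_small_slice (ε := ε / 4) (by positivity)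
  refine ⟨δ / 2, by positivity, by linarith, fun f hf => ?_⟩
  obtain ⟨Z, hZ, hfZ, x, hx, -, hfx, hS⟩ := H (δ / 2) (by positivity) f hf
  refine ⟨Z, hZ, hfZ, x, hx, by linarith, ?_⟩
  have : Metric.diam (wStarSlice Z x (f x * (1 - δ / 2))) ≤ 2 * (ε / 4) :=
    diam_wStarSlice_le (by positivity) fun g hg =>
      hS g ⟨hg.1, hg.2.1, lt_trans (by nlinarith) hg.2.2⟩
  linarith

theorem DualIsWStarAUC.dualIsWStarAUDII (h : DualIsWStarAUC X) : DualIsWStarAUDII X := by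
  intro ε hε
  obtain ⟨δ, hδ, hδ1, H⟩ := h.exists_small_slice (ε := ε / 4) (by positivity)
  refine ⟨δ, hδ, hδ1, fun f hf => ?_⟩
  obtain ⟨Z, hZ, hfZ, x, hx, hxZ, hfx, hS⟩ := H δ hδ f hf
  have := diam_wStarSlice_le (by positivity) hS
  exact ⟨Z, hZ, hfZ, x, hx, hxZ, ⟨hfZ, hf.le, hfx⟩, by linarith⟩

/-- The ball has centre `L • x` and radius `L - ε/2`. A functional in the slice is close to `f`,
hence at least `ε/2` on `C`; one outside loses `L * δ = M + ε` at the centre, which outweighs the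
bound `M` on `C`. Taking `f x` within `ε / (4L)` of 1 keeps `f ≥ ε/4` on the ball. -/
theorem DualIsWStarAUC.hasAHUMIP (h : DualIsWStarAUC X) : HasAHUMIP X := by
  intro ε M hε hM
  obtain ⟨δ, hδ, hδ1, H⟩ := h.exists_small_slice (ε := ε / (2 * M)) (by positivity)
  set L := (M + ε) / δ with hL
  have hL0 : 0 < L := by positivity
  have hLδ : L * δ = M + ε := by rw [hL]; field_simp
  have hLM : M + ε ≤ L := by nlinarith
  refine ⟨ε / 4, L, by positivity, hL0, fun f hf => ?_⟩
  obtain ⟨Z, hZ, hfZ, x, hx, hxZ, hfx, hS⟩ := H (ε / (4 * L)) (by positivity) f hf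
  refine ⟨Z, hZ, hfZ, fun C _ _ hCM hCε => ⟨L • x, L - ε / 2, by linarith, by linarith, ?_, ?_⟩⟩
  · intro c hc
    have hcM : dualSeminorm Z c ≤ M := by simpa [dualClosedBall] using hCM hc
    have key : ∀ g ∈ Z, ‖g‖ ≤ 1 → L * g x - g c ≤ L - ε / 2 := by
      intro g hg hg1
      have hgx := (abs_le.1 (dualSeminorm_le_iff.1 hxZ.le g hg hg1)).2
      have hgc := (abs_le.1 (dualSeminorm_le_iff.1 hcM g hg hg1)).1
      by_cases hgS : 1 - δ < g x
      · have h1 := hS g ⟨hg, hg1, hgS⟩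
        have h2 := abs_apply_le_norm_mul_dualSeminorm (Z.sub_mem hg hfZ) c
        have h3 : ‖g - f‖ * dualSeminorm Z c ≤ ε / (2 * M) * M := by
          refine mul_le_mul h1 hcM ?_ (by positivity)
          exact (abs_nonneg _).trans (dualSeminorm_le_iff.1 le_rfl 0 Z.zero_mem (by simp))
        have h4 : ε / (2 * M) * M = ε / 2 := by field_simp
        have h5 := (abs_le.1 (h2.trans h3)).1
        rw [sub_apply] at h5
        have := hCε c hc
        nlinarith
      · nlinarith
    refine dualSeminorm_le_iff.2 fun g hg hg1 => abs_le.2 ⟨?_, ?_⟩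
    · have := key g hg hg1
      rw [map_sub, map_smul, smul_eq_mul]; linarith
    · have := key (-g) (Z.neg_mem hg) (by rwa [norm_neg])
      rw [neg_apply, neg_apply] at this
      rw [map_sub, map_smul, smul_eq_mul]; linarith
  · intro z hz
    have h1 : ‖z - L • x‖ ≤ L - ε / 2 := by simpa [dist_eq_norm] using hz
    have h2 := (abs_le.1 (f.le_opNorm (z - L • x))).1
    rw [hf, one_mul, map_sub, map_smul, smul_eq_mul] at h2
    have h3 : L * (ε / (4 * L)) = ε / 4 := by field_simp
    nlinarith

/-- The parallel hyperplane lemma: if `|f| ≤ ε` on the unit ball of `ker g`, then `f` is within `ε`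
of a multiple of `g`. -/
theorem exists_norm_sub_smul_le_of_ker {f g : StrongDual ℝ X} {ε : ℝ} (hε : 0 ≤ ε)
    (h : ∀ x, g x = 0 → ‖x‖ ≤ 1 → f x ≤ ε) : ∃ a : ℝ, ‖f - a • g‖ ≤ ε := by
  let p : Submodule ℝ X := LinearMap.ker (g : X →ₗ[ℝ] ℝ)
  -- `u` extends `f` from `ker g` without increasing the norm, so `f - u` vanishes on `ker g` and is
  -- a multiple of `g`.
  obtain ⟨u, hu, hun⟩ := exists_extension_norm_eq p (f.comp p.subtypeL)
  have hb : ‖u‖ ≤ ε := by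
    rw [hun]
    refine ContinuousLinearMap.opNorm_le_of_unit_norm hε fun x hx => ?_
    have hx1 : ‖(x : X)‖ = 1 := hx
    have hgx : g x = 0 := x.2
    rw [ContinuousLinearMap.comp_apply, Submodule.subtypeL_apply, Real.norm_eq_abs, abs_le']
    exact ⟨h x hgx hx1.le, by simpa using h (-x) (by simp [hgx]) (by rw [norm_neg, hx1])⟩
  have hker : LinearMap.ker (g : X →ₗ[ℝ] ℝ) ≤ LinearMap.ker ((f - u : StrongDual ℝ X) : X →ₗ[ℝ] ℝ) := by
    intro x hx
    have := hu ⟨x, hx⟩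
    simp only [ContinuousLinearMap.comp_apply, Submodule.subtypeL_apply] at this
    simp [this]
  have hspan := mem_span_of_iInf_ker_le_ker (ι := Unit) (L := fun _ => (g : X →ₗ[ℝ] ℝ))
    (K := ((f - u : StrongDual ℝ X) : X →ₗ[ℝ] ℝ)) (by simpa using hker)
  rw [Set.range_const, Submodule.mem_span_singleton] at hspan
  obtain ⟨a, ha⟩ := hspan
  refine ⟨a, ?_⟩
  have : f - a • g = u := by
    ext x
    have := LinearMap.congr_fun ha x
    simp at this
    simp; linarith
  rwa [this]

/-- Enclose the part of the `Z`-unit ball where `f ≥ e` in a ball about `z₀`. Any `g` in the slice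
along `z₀` has `g z₀ > r₀`, so it is positive on that part; thus `f < e` on the unit ball of `ker
g`, and `f` is near a multiple of `g`. -/
theorem HasAHUMIP.dualIsWStarAUDI (h : HasAHUMIP X) : DualIsWStarAUDI X := by
  intro ε hε hε2
  set e := ε / 40 with he
  have he0 : 0 < e := by positivity
  have he1 : e ≤ 1 / 20 := by linarith
  obtain ⟨γ, K, hγ, hK, H⟩ := h e 1 he0 le_rfl
  -- The second bound gives `(r₀ + γ)(1 - δ) ≥ r₀` for all `r₀ ≤ K`.
  set δ := min e (γ / (K + γ)) with hδdef
  have hδ : 0 < δ := by positivity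
  have hδe : δ ≤ e := min_le_left _ _
  have hδγ : δ * (K + γ) ≤ γ := by
    rw [← le_div_iff₀ (by positivity)]; exact min_le_right _ _
  refine ⟨δ, hδ, by linarith, fun f hf => ?_⟩
  obtain ⟨Z, hZ, hfZ, HZ⟩ := H f hf
  set C : Set X := {c | dualSeminorm Z c ≤ 1 ∧ e ≤ f c} with hC
  have hCeq : C = (⋂ g ∈ {g | g ∈ Z ∧ ‖g‖ ≤ 1}, {c : X | |g c| ≤ 1}) ∩ {c | e ≤ f c} := by
    ext c
    simp [hC, dualSeminorm_le_iff]
  have hCc : IsClosed C := by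
    rw [hCeq]
    refine IsClosed.inter (isClosed_biInter fun g _ => ?_)
      (isClosed_le continuous_const f.continuous)
    exact isClosed_le (continuous_abs.comp g.continuous) continuous_const
  have hCconv : Convex ℝ C := by
    intro a ha b hb s t hs ht hst
    refine ⟨dualSeminorm_le_iff.2 fun g hg hg1 => ?_, ?_⟩
    · have h1 := abs_le.1 (dualSeminorm_le_iff.1 ha.1 g hg hg1)
      have h2 := abs_le.1 (dualSeminorm_le_iff.1 hb.1 g hg hg1)
      rw [map_add, map_smul, map_smul, smul_eq_mul, smul_eq_mul, abs_le]
      constructor <;> nlinarith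
    · rw [map_add, map_smul, map_smul, smul_eq_mul, smul_eq_mul]
      nlinarith [ha.2, hb.2]
  obtain ⟨z₀, r₀, hr0, hrK, hCB, hfz⟩ := HZ C hCc hCconv
    (fun c hc => by simpa [dualClosedBall] using hc.1) (fun c hc => hc.2)
  have hball : ∀ c ∈ C, ∀ g ∈ Z, ‖g‖ ≤ 1 → |g c - g z₀| ≤ r₀ := fun c hc g hg hg1 => by
    rw [← map_sub]
    exact dualSeminorm_le_iff.1 (hCB hc) g hg hg1
  have hfz0 : r₀ + γ ≤ f z₀ := by
    by_contra! hcon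
    obtain ⟨x, hx, hfx⟩ := exists_norm_eq_one_lt_apply hf (c := 1 - (r₀ + γ - f z₀) / r₀) (by
      have : 0 < (r₀ + γ - f z₀) / r₀ := by apply div_pos <;> linarith
      linarith)
    have h1 := hfz (z₀ - r₀ • x) (by
      simp [norm_smul, hx, abs_of_pos hr0])
    rw [map_sub, map_smul, smul_eq_mul] at h1
    have h2 : r₀ * (1 - (r₀ + γ - f z₀) / r₀) = f z₀ - γ := by field_simp; ring
    nlinarith
  -- Two points of `C` with well separated `f`-values bound `r₀` below, so `‖z₀‖_Z ≤ r₀ + 1` is at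
  -- most a fixed multiple of `f z₀`. This makes the error at `z₀` relative to `f z₀`.
  obtain ⟨c₁, hc₁, hfc₁⟩ := exists_norm_eq_one_lt_apply hf (c := 3 / 4) (by norm_num)
  have hc₁1 : f c₁ ≤ 1 := by
    have := (le_abs_self _).trans (f.le_opNorm c₁)
    rwa [hf, hc₁, mul_one] at this
  have hc₁C : c₁ ∈ C := ⟨(dualSeminorm_le_norm _ _).trans hc₁.le, by linarith⟩
  have hc₂C : (e / f c₁) • c₁ ∈ C := by
    refine ⟨(dualSeminorm_le_norm _ _).trans ?_, ?_⟩
    · rw [norm_smul, hc₁, mul_one, Real.norm_of_nonneg (by positivity), div_le_one (by linarith)]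
      linarith
    · rw [map_smul, smul_eq_mul, div_mul_cancel₀ _ (by linarith)]
  have hr4 : 1 / 4 ≤ r₀ := by
    have h1 := (abs_le.1 (hball _ hc₁C f hfZ hf.le)).2
    have h2 := (abs_le.1 (hball _ hc₂C f hfZ hf.le)).1
    rw [map_smul, smul_eq_mul, div_mul_cancel₀ _ (by linarith)] at h2
    linarith
  have hz5 : dualSeminorm Z z₀ ≤ 5 * f z₀ := by
    refine dualSeminorm_le_iff.2 fun g hg hg1 => ?_
    have h1 := abs_le.1 (hball _ hc₁C g hg hg1)
    have h2 := abs_le.1 (dualSeminorm_le_iff.1 hc₁C.1 g hg hg1)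
    exact abs_le.2 ⟨by linarith, by linarith⟩
  have hfzpos : 0 < f z₀ := by linarith
  have hz0 : 0 < ‖z₀‖ := norm_pos_iff.2 fun h => by simp [h] at hfzpos
  have hlevel : r₀ ≤ f z₀ * (1 - δ) := by nlinarith
  refine ⟨Z, hZ, hfZ, ‖z₀‖⁻¹ • z₀, by rw [norm_smul, norm_inv, norm_norm, inv_mul_cancel₀ hz0.ne'],
    by rw [map_smul, smul_eq_mul]; positivity, ?_⟩
  refine (diam_wStarSlice_le (r := 10 * e) (f := f) (by positivity) ?_).trans_lt (by linarith)
  rintro g ⟨hgZ, hg1, hg⟩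
  have hgz : f z₀ * (1 - δ) < g z₀ := by
    rw [map_smul, map_smul, smul_eq_mul, smul_eq_mul, mul_assoc] at hg
    exact lt_of_mul_lt_mul_left hg (by positivity)
  have hgC : ∀ c ∈ C, 0 < g c := fun c hc => by
    have := (abs_le.1 (hball c hc g hgZ hg1)).1
    linarith
  obtain ⟨a, ha⟩ := exists_norm_sub_smul_le_of_ker (f := f) (g := g) he0.le fun x hgx hx => by
    by_contra! hcon
    exact (hgC x ⟨(dualSeminorm_le_norm _ _).trans hx, hcon.le⟩).ne' hgx
  have h1 : |f z₀ - a * g z₀| ≤ e * (5 * f z₀) := by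
    have := abs_apply_le_norm_mul_dualSeminorm (Z.sub_mem hfZ (Z.smul_mem a hgZ)) z₀
    refine (this.trans ?_)
    exact mul_le_mul ha hz5
      ((abs_nonneg _).trans (dualSeminorm_le_iff.1 le_rfl 0 Z.zero_mem (by simp))) he0.le
  have h2 := abs_le.1 h1
  have ha0 : 0 < a := by
    by_contra! hcon
    nlinarith
  -- The upper bound on `a` comes from evaluation at `z₀`, the lower one from comparing norms.
  have hau : a ≤ 1 + 8 * e := by
    have h3 : f z₀ * (a * (1 - δ)) ≤ f z₀ * (1 + 5 * e) := by
      have := mul_le_mul_of_nonneg_left hgz.le ha0.le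
      linarith
    have h4 : a * (1 - δ) ≤ 1 + 5 * e := le_of_mul_le_mul_left h3 hfzpos
    have h5 : a * (1 - e) ≤ a * (1 - δ) := by gcongr
    have h6 : 1 + 5 * e ≤ (1 + 8 * e) * (1 - e) := by nlinarith
    exact le_of_mul_le_mul_right (h5.trans (h4.trans h6)) (by linarith)
  have hal : 1 - e ≤ a := by
    have h3 := norm_sub_norm_le f (a • g)
    rw [norm_smul, hf, Real.norm_of_nonneg ha0.le] at h3
    have h4 : a * ‖g‖ ≤ a := mul_le_of_le_one_right ha0.le hg1
    linarith
  have h5 : g - f = (1 - a) • g - (f - a • g) := by module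
  rw [h5]
  refine (norm_sub_le _ _).trans ?_
  rw [norm_smul, Real.norm_eq_abs]
  have h6 : |1 - a| ≤ 8 * e := abs_le.2 ⟨by linarith, by linarith⟩
  have h7 : |1 - a| * ‖g‖ ≤ |1 - a| := mul_le_of_le_one_right (abs_nonneg _) hg1
  linarith

end AsymptoticDenting

/-! ### Duality between AUS and w*-AUC. -/

section AsymptoticSmoothness

variable {X : Type*} [NormedAddCommGroup X] [NormedSpace ℝ X]

theorem bddAbove_norm_add_sub_one {x : X} (hx : ‖x‖ = 1) (Y : Submodule ℝ X) (t : ℝ) :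
    BddAbove (Set.range fun y : {y : X // y ∈ Y ∧ ‖y‖ = t} => ‖x + y.1‖ - 1) := by
  refine ⟨t, ?_⟩
  rintro _ ⟨y, rfl⟩
  have := norm_add_le x y.1
  rw [hx, y.2.2] at this
  change ‖x + y.1‖ - 1 ≤ t
  linarith

theorem iSup_norm_add_sub_one_nonneg {x : X} (hx : ‖x‖ = 1) (Y : Submodule ℝ X) (t : ℝ) :
    0 ≤ ⨆ y : {y : X // y ∈ Y ∧ ‖y‖ = t}, (‖x + y.1‖ - 1) := by
  rcases isEmpty_or_nonempty {y : X // y ∈ Y ∧ ‖y‖ = t} with h | ⟨⟨y, hy, hyt⟩⟩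
  · rw [Real.iSup_of_isEmpty]
  · have h1 := le_ciSup (bddAbove_norm_add_sub_one hx Y t) ⟨y, hy, hyt⟩
    have h2 := le_ciSup (bddAbove_norm_add_sub_one hx Y t)
      ⟨-y, Y.neg_mem hy, by rwa [norm_neg]⟩
    have h3 := norm_add_le (x + y) (x + -y)
    have h4 : x + y + (x + -y) = (2 : ℝ) • x := by module
    rw [h4, norm_smul, hx] at h3
    norm_num at h3 h1 h2
    linarith

theorem ausModulus_nonneg (t : ℝ) : 0 ≤ ausModulus X t :=
  Real.iSup_nonneg fun x => Real.iInf_nonneg fun Y => iSup_norm_add_sub_one_nonneg x.2 Y.1 t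

theorem bddBelow_iSup_norm_add_sub_one {x : X} (hx : ‖x‖ = 1) (t : ℝ) :
    BddBelow (Set.range fun Y : {Y : Submodule ℝ X // FiniteDimensional ℝ (X ⧸ Y)} =>
      ⨆ y : {y : X // y ∈ Y.1 ∧ ‖y‖ = t}, (‖x + y.1‖ - 1)) := by
  refine ⟨0, ?_⟩
  rintro _ ⟨Y, rfl⟩
  exact iSup_norm_add_sub_one_nonneg hx Y.1 t

theorem ausModulus_le {t c : ℝ} (hc : 0 ≤ c)
    (h : ∀ x : X, ‖x‖ = 1 → ∃ Y : Submodule ℝ X, FiniteDimensional ℝ (X ⧸ Y) ∧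
      ∀ y ∈ Y, ‖y‖ = t → ‖x + y‖ ≤ 1 + c) : ausModulus X t ≤ c := by
  refine Real.iSup_le (fun x => ?_) hc
  obtain ⟨Y, hY, H⟩ := h x.1 x.2
  refine (ciInf_le (bddBelow_iSup_norm_add_sub_one x.2 t) ⟨Y, hY⟩).trans ?_
  refine Real.iSup_le (fun y => ?_) hc
  linarith [H y.1 y.2.1 y.2.2]

theorem exists_of_ausModulus_lt {t c : ℝ} (ht : 0 ≤ t) (h : ausModulus X t < c) {x : X}
    (hx : ‖x‖ = 1) : ∃ Y : Submodule ℝ X, FiniteDimensional ℝ (X ⧸ Y) ∧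
      ∀ y ∈ Y, ‖y‖ = t → ‖x + y‖ ≤ 1 + c := by
  have : Nonempty {Y : Submodule ℝ X // FiniteDimensional ℝ (X ⧸ Y)} := ⟨⟨⊤, inferInstance⟩⟩
  have hb : BddAbove (Set.range fun x : {x : X // ‖x‖ = 1} =>
      ⨅ Y : {Y : Submodule ℝ X // FiniteDimensional ℝ (X ⧸ Y)},
        ⨆ y : {y : X // y ∈ Y.1 ∧ ‖y‖ = t}, (‖x.1 + y.1‖ - 1)) := by
    refine ⟨t, ?_⟩
    rintro _ ⟨x, rfl⟩
    refine (ciInf_le (bddBelow_iSup_norm_add_sub_one x.2 t) ⟨⊤, inferInstance⟩).trans ?_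
    refine Real.iSup_le (fun y => ?_) ht
    have := norm_add_le x.1 y.1
    rw [x.2, y.2.2] at this
    linarith
  have h1 := (le_ciSup hb ⟨x, hx⟩).trans_lt h
  obtain ⟨Y, hY⟩ := exists_lt_of_ciInf_lt h1
  refine ⟨Y.1, Y.2, fun y hy hyt => ?_⟩
  have := le_ciSup (bddAbove_norm_add_sub_one hx Y.1 t) ⟨y, hy, hyt⟩
  change ‖x + y‖ - 1 ≤ _ at this
  linarith

/-- For `Y` of finite codimension, there is a finite-dimensional `F` such that `Y` is
`1/3`-norming for the annihilator of `F`. -/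
theorem exists_finiteDimensional_norm_le_three_mul (Y : Submodule ℝ X)
    [FiniteDimensional ℝ (X ⧸ Y)] :
    ∃ F : Submodule ℝ X, FiniteDimensional ℝ F ∧ ∀ g ∈ topDualAnnihilator F, ∀ r : ℝ, 0 ≤ r →
      (∀ y ∈ Y, g y ≤ r * ‖y‖) → ‖g‖ ≤ 3 * r := by
  -- `Y` need not be closed; its closure has a normed quotient, and bounds on `Y` extend by
  -- continuity.
  let W := Y.topologicalClosure
  have hWc : IsClosed (W : Set X) := Y.isClosed_topologicalClosure
  have hWf : FiniteDimensional ℝ (X ⧸ W) :=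
    Submodule.CoFG.of_le Y.le_topologicalClosure ‹_›
  have : ProperSpace (X ⧸ W) := FiniteDimensional.proper ℝ _
  have htb : TotallyBounded (W.mkQ '' Metric.closedBall 0 1) := by
    refine (isCompact_closedBall (0 : X ⧸ W) 1).totallyBounded.subset ?_
    rintro _ ⟨x, hx, rfl⟩
    rw [mem_closedBall_zero_iff] at hx ⊢
    exact (Submodule.Quotient.norm_mk_le W x).trans hx
  obtain ⟨T, hTs, hTf, hT⟩ := Metric.finite_approx_of_totallyBounded htb (1 / 4) (by norm_num)
  have hsec : ∀ q ∈ T, ∃ x : X, ‖x‖ ≤ 1 ∧ W.mkQ x = q := fun q hq => by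
    obtain ⟨x, hx, rfl⟩ := hTs hq
    exact ⟨x, mem_closedBall_zero_iff.1 hx, rfl⟩
  choose! v hv1 hv using hsec
  refine ⟨Submodule.span ℝ (v '' T), FiniteDimensional.span_of_finite ℝ (hTf.image v),
    fun g hg r hr0 hr => ?_⟩
  have hrW : ∀ y ∈ W, g y ≤ r * ‖y‖ := by
    have hcl : IsClosed {y : X | g y ≤ r * ‖y‖} :=
      isClosed_le g.continuous (continuous_const.mul continuous_norm)
    exact fun y hy => closure_minimal (fun y hy => hr y hy) hcl hy
  -- Write `x` as a lifted net point, killed by `g`, plus `m` of norm below `1/4`, plus an element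
  -- of `W` of norm at most `9/4`. Absorbing `‖g‖ / 4` then gives the constant 3.
  have hone : ∀ x : X, ‖x‖ ≤ 1 → g x ≤ ‖g‖ / 4 + 9 / 4 * r := by
    intro x hx
    obtain ⟨q, hq, hxq⟩ := Set.mem_iUnion₂.1 (hT ⟨x, mem_closedBall_zero_iff.2 hx, rfl⟩)
    have hd : ‖W.mkQ (x - v q)‖ < 1 / 4 := by
      rwa [map_sub, hv q hq, ← dist_eq_norm]
    obtain ⟨m, hm, hmn⟩ := QuotientAddGroup.norm_lt_iff.1 hd
    have hyW : x - v q - m ∈ W := by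
      rw [← Submodule.Quotient.mk_eq_zero, Submodule.Quotient.mk_sub, sub_eq_zero]
      exact hm.symm
    have hgv : g (v q) = 0 := hg _ (Submodule.subset_span ⟨q, hq, rfl⟩)
    have h1 := hrW _ hyW
    have h2 : ‖x - v q - m‖ ≤ 9 / 4 := by
      have := norm_sub_le (x - v q) m
      have := norm_sub_le x (v q)
      have := hv1 q hq
      linarith
    have h3 := (le_abs_self _).trans (g.le_opNorm m)
    rw [map_sub, map_sub, hgv] at h1
    nlinarith [norm_nonneg g]
  have : ‖g‖ ≤ ‖g‖ / 4 + 9 / 4 * r := by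
    refine ContinuousLinearMap.opNorm_le_of_unit_norm (by positivity) fun x hx => ?_
    rw [Real.norm_eq_abs, abs_le']
    exact ⟨hone x hx.le, by simpa using hone (-x) (by rw [norm_neg, hx])⟩
  linarith

theorem IsAUS.dualIsWStarAUC (h : IsAUS X) : DualIsWStarAUC X := by
  rw [dualIsWStarAUC_iff]
  intro t ht
  obtain ⟨σ, hρ, hσ⟩ := ((h.eventually (gt_mem_nhds (show 0 < t / 12 by positivity))).and
    self_mem_nhdsWithin).exists
  have hσ : 0 < σ := hσ
  rw [div_lt_iff₀ hσ] at hρ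
  -- The norming lemma yields a gain `tσ/3`; losing `tσ/12` in `f x` and dividing by the bound on
  -- `‖x + y‖` leaves `(1 + tσ/4) / (1 + tσ/12)`, which is 1 plus this witness.
  refine ⟨(t * σ / 6) / (1 + t / 12 * σ), by positivity, fun f hf => ?_⟩
  obtain ⟨x, hx, hfx⟩ := exists_norm_eq_one_lt_apply hf (c := 1 - t / 12 * σ)
    (by linarith [mul_pos (show 0 < t / 12 by positivity) hσ])
  obtain ⟨Y, hY, HY⟩ := exists_of_ausModulus_lt hσ.le hρ hx
  have : FiniteDimensional ℝ (X ⧸ (Y ⊓ LinearMap.ker (f : X →ₗ[ℝ] ℝ))) :=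
    Submodule.CoFG.inf hY (Submodule.CoFG.ker _)
  obtain ⟨F, hF, HF⟩ :=
    exists_finiteDimensional_norm_le_three_mul (Y ⊓ LinearMap.ker (f : X →ₗ[ℝ] ℝ))
  obtain ⟨Z, hZ, HZ⟩ := (isWStarCofinite_topDualAnnihilator F).inf_eval x
  refine ⟨Z, hZ, fun g hg hgt => ?_⟩
  obtain ⟨hgF, hgx⟩ := HZ g hg
  set N := ‖f + g‖ with hN
  set r := (N * (1 + t / 12 * σ) - f x) / σ with hr
  have h1 : ∀ y ∈ Y ⊓ LinearMap.ker (f : X →ₗ[ℝ] ℝ), g y ≤ max 0 r * ‖y‖ := by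
    rintro y ⟨hyY, hfy⟩
    rcases eq_or_ne y 0 with rfl | hy0
    · simp
    have hn : 0 < ‖y‖ := norm_pos_iff.2 hy0
    have hfy : f y = 0 := hfy
    set c := σ / ‖y‖ with hc
    have hc0 : 0 < c := by positivity
    have hxy := HY (c • y) (Y.smul_mem c hyY) (by
      rw [norm_smul, Real.norm_of_nonneg hc0.le, hc, div_mul_cancel₀ _ hn.ne'])
    have h2 := (le_abs_self _).trans ((f + g).le_opNorm (x + c • y))
    have h3 : (f + g) (x + c • y) = f x + c * g y := by
      simp [hfy, hgx]
    rw [h3] at h2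
    have h4 : N * ‖x + c • y‖ ≤ N * (1 + t / 12 * σ) := by gcongr
    have h5 : c * g y ≤ σ * r := by
      rw [hr, mul_div_cancel₀ _ hσ.ne']; linarith
    have h6 : g y ≤ r * ‖y‖ := by
      rw [hc, div_mul_eq_mul_div, div_le_iff₀ hn, mul_assoc] at h5
      exact le_of_mul_le_mul_left h5 hσ
    exact h6.trans (by gcongr; exact le_max_right _ _)
  have h2 := HF g hgF _ (le_max_left 0 r) h1
  rw [hgt] at h2
  have h3 : t ≤ 3 * r := by
    rcases le_total r 0 with h | h
    · rw [max_eq_left h] at h2; linarith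
    · rwa [max_eq_right h] at h2
  have h4 : t * σ ≤ 3 * (N * (1 + t / 12 * σ) - f x) := by
    have := mul_le_mul_of_nonneg_right h3 hσ.le
    rwa [hr, mul_assoc, div_mul_cancel₀ _ hσ.ne'] at this
  have hp : 0 < 1 + t / 12 * σ := by positivity
  have h5 : 1 + t * σ / 6 / (1 + t / 12 * σ) = (1 + t / 4 * σ) / (1 + t / 12 * σ) := by
    field_simp; ring
  rw [h5, div_le_iff₀ hp]
  linarith

/-- A uniform w*-Kadec–Klee property near the sphere. If `ψ` is close to `φ` on `F`, correcting by a
small Hahn–Banach extension puts the difference in the annihilator of `F`; were it large, w*-AUC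
would force `ψ` out of the unit ball. -/
theorem DualIsWStarAUC.exists_nhds (h : DualIsWStarAUC X) {τ : ℝ} (hτ : 0 < τ) :
    ∃ c : ℝ, c < 1 ∧ ∀ φ : WeakDual ℝ X, ‖WeakDual.toStrongDual φ‖ ≤ 1 →
      c ≤ ‖WeakDual.toStrongDual φ‖ → ∃ U ∈ 𝓝 φ, ∀ ψ ∈ U, ‖WeakDual.toStrongDual ψ‖ ≤ 1 →
        ‖WeakDual.toStrongDual ψ - WeakDual.toStrongDual φ‖ ≤ τ := by
  obtain ⟨η, hη, H⟩ := h.exists_annihilator (t := τ / 2) (by positivity)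
  have hc : (1 + η / 2) / (1 + η) < 1 := by rw [div_lt_one (by positivity)]; linarith
  refine ⟨(1 + η / 2) / (1 + η), hc, fun φ hφ1 hφ => ?_⟩
  set f := WeakDual.toStrongDual φ with hf
  have hf0 : 0 < ‖f‖ := lt_of_lt_of_le (by positivity) hφ
  obtain ⟨F, hF, HF⟩ := H (‖f‖⁻¹ • f) (by rw [norm_smul, norm_inv, norm_norm, inv_mul_cancel₀ hf0.ne'])
  have hs : 0 < min (η / 4) (τ / 2) := by positivity
  set s := min (η / 4) (τ / 2) with hsd
  let R : WeakDual ℝ X → StrongDual ℝ F :=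
    fun ψ => (WeakDual.toStrongDual ψ - f).comp F.subtypeL
  have hR : Continuous R := by
    rw [continuous_clm_apply]
    intro y
    exact (WeakDual.eval_continuous (y : X)).sub continuous_const
  refine ⟨R ⁻¹' Metric.ball 0 s, ?_, ?_⟩
  · refine (Metric.isOpen_ball.preimage hR).mem_nhds ?_
    simp [R, hf, hs]
  · intro ψ hψ hψ1
    set k := WeakDual.toStrongDual ψ with hk
    obtain ⟨u, hu, hun⟩ := exists_extension_norm_eq F (R ψ)
    have hus : ‖u‖ < s := by rw [hun]; exact (mem_ball_zero_iff (a := R ψ)).1 hψ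
    have hgF : k - f - u ∈ topDualAnnihilator F := fun y hy => by
      have := hu ⟨y, hy⟩
      simp only [R, ContinuousLinearMap.comp_apply, Submodule.subtypeL_apply] at this
      rw [sub_apply, this, sub_self]
    have hg : ‖k - f - u‖ < τ / 2 := by
      by_contra! hcon
      have h1 := HF (‖f‖⁻¹ • (k - f - u)) (Submodule.smul_mem _ _ hgF) (by
        rw [norm_smul, norm_inv, norm_norm]
        refine hcon.trans (le_mul_of_one_le_left (norm_nonneg _) ((one_le_inv₀ hf0).2 hφ1)))
      have h2 : ‖f‖⁻¹ • f + ‖f‖⁻¹ • (k - f - u) = ‖f‖⁻¹ • (k - u) := by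
        rw [← smul_add]; congr 1; abel
      rw [h2, norm_smul, norm_inv, norm_norm, le_inv_mul_iff₀ hf0] at h1
      have h3 := norm_sub_le k u
      have h4 : 1 + η / 2 ≤ ‖f‖ * (1 + η) := (div_le_iff₀ (by positivity)).1 hφ
      have := min_le_left (η / 4) (τ / 2)
      linarith
    have h1 := norm_add_le (k - f - u) u
    rw [sub_add_cancel] at h1
    have := min_le_right (η / 4) (τ / 2)
    linarith

/-- Functionals in the dual ball nearly norming `x` form a w*-compact set, covered by finitely many
small neighbourhoods; `Y` is the common kernel of their centres. A functional norming `x + y` lies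
within `τ` of a centre, so its value at `y` is at most `τ * σ`. -/
theorem DualIsWStarAUC.exists_ausModulus_le (h : DualIsWStarAUC X) {τ : ℝ} (hτ : 0 < τ) :
    ∃ σ₀ : ℝ, 0 < σ₀ ∧ ∀ σ : ℝ, 0 < σ → σ < σ₀ → ausModulus X σ ≤ τ * σ := by
  obtain ⟨c, hc, H⟩ := h.exists_nhds hτ
  refine ⟨(1 - c) / 2, by linarith, fun σ hσ hσ₀ => ausModulus_le (by positivity) fun x hx => ?_⟩
  -- One `σ` allows for `‖x + y‖ ≥ 1 - σ`, the other for `k y ≤ σ`.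
  let K : Set (WeakDual ℝ X) :=
    WeakDual.toStrongDual ⁻¹' Metric.closedBall 0 1 ∩ {φ | 1 - 2 * σ ≤ φ x}
  have hK : IsCompact K := (WeakDual.isCompact_closedBall (0 : StrongDual ℝ X) 1).inter_right
    (isClosed_le continuous_const (WeakDual.eval_continuous x))
  have hKU : ∀ φ ∈ K, ∃ U ∈ 𝓝 φ, ∀ ψ ∈ U, ‖WeakDual.toStrongDual ψ‖ ≤ 1 →
      ‖WeakDual.toStrongDual ψ - WeakDual.toStrongDual φ‖ ≤ τ := by
    rintro φ ⟨hφ1, hφ⟩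
    refine H φ (by simpa using hφ1) ?_
    have h1 := (le_abs_self _).trans ((WeakDual.toStrongDual φ).le_opNorm x)
    rw [hx, mul_one, WeakDual.toStrongDual_apply] at h1
    have : 1 - 2 * σ ≤ φ x := hφ
    linarith
  choose! U hU hUτ using hKU
  obtain ⟨T, hTK, hT⟩ := hK.elim_nhds_subcover U hU
  let L : X →ₗ[ℝ] (T → ℝ) := LinearMap.pi fun φ => (WeakDual.toStrongDual φ.1 : X →ₗ[ℝ] ℝ)
  refine ⟨LinearMap.ker L, Submodule.CoFG.ker L, fun y hy hyσ => ?_⟩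
  obtain ⟨k, hk1, hk⟩ := exists_dual_vector'' ℝ (x + y)
  simp only [map_add, RCLike.ofReal_real_eq_id, id_eq] at hk
  have hky := (le_abs_self _).trans (k.le_opNorm y)
  have hkx := (le_abs_self _).trans (k.le_opNorm x)
  rw [hyσ] at hky
  rw [hx] at hkx
  have hxy : 1 - σ ≤ ‖x + y‖ := by
    have := norm_sub_le (x + y) y
    rw [add_sub_cancel_right, hx, hyσ] at this
    linarith
  have hkK : StrongDual.toWeakDual k ∈ K := by
    refine ⟨by simpa using hk1, ?_⟩
    change 1 - 2 * σ ≤ k x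
    nlinarith
  obtain ⟨φ, hφT, hφU⟩ := Set.mem_iUnion₂.1 (hT hkK)
  have h1 : ‖k - WeakDual.toStrongDual φ‖ ≤ τ := hUτ φ (hTK φ hφT) _ hφU hk1
  have h2 : WeakDual.toStrongDual φ y = 0 := congrFun (LinearMap.mem_ker.1 hy) ⟨φ, hφT⟩
  have h3 := (le_abs_self _).trans ((k - WeakDual.toStrongDual φ).le_opNorm y)
  rw [sub_apply, h2, sub_zero, hyσ] at h3
  nlinarith

theorem DualIsWStarAUC.isAUS (h : DualIsWStarAUC X) : IsAUS X := by
  rw [IsAUS, Metric.tendsto_nhds]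
  intro ε hε
  obtain ⟨σ₀, hσ₀, H⟩ := h.exists_ausModulus_le (half_pos hε)
  filter_upwards [Ioo_mem_nhdsGT hσ₀] with σ hσ
  have h1 := H σ hσ.1 hσ.2
  have h2 := ausModulus_nonneg (X := X) σ
  rw [dist_zero_right, Real.norm_of_nonneg (div_nonneg h2 hσ.1.le), div_lt_iff₀ hσ.1]
  nlinarith [hσ.1]

end AsymptoticSmoothness

theorem theorem4 (X : Type*) [NormedAddCommGroup X] [NormedSpace ℝ X] [CompleteSpace X] :
    List.TFAE [IsAUS X, DualIsWStarAUC X, DualIsWStarAUDI X, DualIsWStarAUDII X, HasAHUMIP X] := by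
  tfae_have 1 → 2 := IsAUS.dualIsWStarAUC
  tfae_have 2 → 1 := DualIsWStarAUC.isAUS
  tfae_have 2 → 3 := DualIsWStarAUC.dualIsWStarAUDI
  tfae_have 3 → 2 := DualIsWStarAUDI.dualIsWStarAUC
  tfae_have 2 → 4 := DualIsWStarAUC.dualIsWStarAUDII
  tfae_have 4 → 2 := DualIsWStarAUDII.dualIsWStarAUC
  tfae_have 2 → 5 := DualIsWStarAUC.hasAHUMIP
  tfae_have 5 → 3 := HasAHUMIP.dualIsWStarAUDI
  tfae_finish
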